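/- Let $\mathcal L\subseteq\{+,-,0\}^E$ be the set of covectors of an oriented matroid on a finite ground set $E$. Order sign vectors componentwise by $0<+$ and $0<-$ (with $+$ and $-$ incomparable). Let $\mathcal T$ be the set of topes, i.e. of maximal covectors. For $P,Q\in\mathcal T$ put $\mathrm{Sep}(P,Q)=\{f\in E : P_f=-Q_f\neq 0\}$, and for a covector $X$ put $\mathrm{star}(X)=\{T\in\mathcal T : X\le T\}$. Fix $R\in\mathcal T$ and $e\in E$, and order $\mathcal T$ by $P\preceq_R Q$ if and only if $\mathrm{Sep}(R,P)\subseteq\mathrm{Sep}(R,Q)$. Let $\mathcal T_{R,e}$ be the poset $\{T\in\mathcal T : T_e=-R_e\}\cup\{\hat 0\}$, in which $\hat 0$ is the least element and the topes are ordered by $\preceq_R$. For a tope $P\in\mathcal T_{R,e}$ let $(\hat 0,P)_{R,e}$ be the open interval between $\hat 0$ and $P$ in $\mathcal T_{R,e}$. A finite poset is called contractible if the geometric realization of its order complex (the simplicial complex of its nonempty chains) is contractible. Its Möbius number is the value $\mu(\hat 0,\hat 1)$ of the Möbius function of the poset obtained from it by adjoining a new least element $\hat 0$ and a new greatest element $\hat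 1$. **Theorem 3.5.** Suppose that $e$ defines a proper face of $R$, i.e. that there is a covector $X\neq\mathbf 0$ in $\mathcal L$ with $X\le R$ and $X_e=0$. Let $F\in\mathcal L$ be the maximal covector such that $F\le R$ and $F_e=0$. Then for every tope $P_{top}\in\mathcal T_{R,e}$ with $P_{top}\notin\mathrm{star}(F)$ the interval $(\hat 0,P_{top})_{R,e}$ is contractible. In particular, its Möbius number is $0$. -/

import Mathlib

/-! ### Sign vectors -/

/-- Sign vectors `X ∈ {+, -, 0}^E`.  This is a separate name for `E → SignType` because the order
used on sign vectors is not the one that Mathlib puts on `E → SignType`. -/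
def SignVector (E : Type*) : Type _ := E → SignType

namespace SignVector

variable {E : Type*}

instance [Finite E] : Finite (SignVector E) := inferInstanceAs (Finite (E → SignType))

/-- The zero sign vector `𝟎 = (0)_{e ∈ E}`. -/
instance : Zero (SignVector E) := ⟨fun _ => 0⟩

instance : Neg (SignVector E) := ⟨fun X e => -X e⟩

/-- The product order induced by the order `0 < +, -` (with `+` and `-` incomparable). -/
instance : PartialOrder (SignVector E) where
  le X Y := ∀ e, X e = 0 ∨ X e = Y e
  le_refl _ _ := Or.inr rfl
  le_trans X Y Z hXY hYZ e := by
    rcases hXY e with h | h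
    · exact Or.inl h
    · rcases hYZ e with h' | h'
      · exact Or.inl (h.trans h')
      · exact Or.inr (h.trans h')
  le_antisymm X Y hXY hYX := by
    funext e
    rcases hXY e with h | h
    · rcases hYX e with h' | h'
      · exact h.trans h'.symm
      · exact h'.symm
    · exact h

/-- The composition `X ∘ Y`. -/
def comp (X Y : SignVector E) : SignVector E := fun e => if X e = 0 then Y e else X e

/-- The separator `Sep(X, Y) = {e | X_e = -Y_e ≠ 0}`. -/
def sep (X Y : SignVector E) : Set E := {e | X e = -Y e ∧ X e ≠ 0}

end SignVector

/-! ### Oriented matroids and their topes -/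

/-- An oriented matroid on the ground set `E`, given by its set of covectors, which satisfies the
covector axioms. -/
structure OrientedMatroid (E : Type*) where
  covectors : Set (SignVector E)
  zero_mem : 0 ∈ covectors
  neg_mem : ∀ X ∈ covectors, -X ∈ covectors
  comp_mem : ∀ X ∈ covectors, ∀ Y ∈ covectors, X.comp Y ∈ covectors
  elimination : ∀ X ∈ covectors, ∀ Y ∈ covectors, ∀ e ∈ X.sep Y,
    ∃ Z ∈ covectors, Z e = 0 ∧ ∀ f ∉ X.sep Y, Z f = X.comp Y f ∧ Z f = Y.comp X f

namespace OrientedMatroid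

variable {E : Type*} (L : OrientedMatroid E)

/-- A tope is a maximal covector. -/
def Tope : Type _ := {T : SignVector E // Maximal (· ∈ L.covectors) T}

instance [Finite E] : Finite L.Tope :=
  inferInstanceAs (Finite {T : SignVector E // Maximal (· ∈ L.covectors) T})

variable {L}

/-- The sign vector of a tope. -/
def Tope.toSignVector (T : L.Tope) : SignVector E := T.1

instance : CoeOut L.Tope (SignVector E) := ⟨Tope.toSignVector⟩

/-- All topes vanish at the same elements of the ground set (the loops). -/
theorem Tope.eq_zero_of_eq_zero (P Q : L.Tope) (e : E) (h : P.toSignVector e = 0) :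
    Q.toSignVector e = 0 := by
  have hle : P.toSignVector ≤ P.toSignVector.comp Q := by
    intro f
    by_cases hf : P.toSignVector f = 0
    · exact Or.inl hf
    · exact Or.inr (if_neg hf).symm
  rcases P.2.2 (L.comp_mem _ P.2.1 _ Q.2.1) hle e with h' | h'
  · exact (if_pos h).symm.trans h'
  · exact ((if_pos h).symm.trans h').trans h

/-- A tope is determined by its separator from a fixed base tope. -/
theorem Tope.eq_of_sep_eq (R P Q : L.Tope)
    (h : R.toSignVector.sep P = R.toSignVector.sep Q) : P = Q := by
  apply Subtype.ext
  funext e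
  change P.toSignVector e = Q.toSignVector e
  have hPR := Tope.eq_zero_of_eq_zero P R e
  have hQR := Tope.eq_zero_of_eq_zero Q R e
  have hRP := Tope.eq_zero_of_eq_zero R P e
  have hRQ := Tope.eq_zero_of_eq_zero R Q e
  have he : e ∈ R.toSignVector.sep P ↔ e ∈ R.toSignVector.sep Q := by rw [h]
  simp only [SignVector.sep, Set.mem_ofPred_eq] at he
  revert hPR hQR hRP hRQ he
  generalize P.toSignVector e = p
  generalize Q.toSignVector e = q
  generalize R.toSignVector e = r
  revert p q r
  decide

/-- `star(X)`, the set of topes `T` with `X ≤ T`. -/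
def star (X : SignVector E) : Set L.Tope := {T | X ≤ (T : SignVector E)}

/-- `e` defines a proper face of the tope `P`: some covector `F ≤ P` with `F_e = 0` is nonzero. -/
def DefinesProperFace (e : E) (P : L.Tope) : Prop :=
  ∃ F ∈ L.covectors, F ≤ (P : SignVector E) ∧ F e = 0 ∧ F ≠ 0

/-- The tope poset `𝒯_R` with base tope `R`: the topes of `L`, ordered by
`P ≼_R Q ↔ Sep(R, P) ⊆ Sep(R, Q)`. -/
def TopePoset (_R : L.Tope) : Type _ := L.Tope

/-- The tope underlying an element of `𝒯_R`. -/
def TopePoset.toTope {R : L.Tope} (P : TopePoset R) : L.Tope := P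

instance (R : L.Tope) [Finite E] : Finite (TopePoset R) := inferInstanceAs (Finite L.Tope)

instance (R : L.Tope) : PartialOrder (TopePoset R) where
  le P Q := R.toSignVector.sep P.toTope ⊆ R.toSignVector.sep Q.toTope
  le_refl _ := subset_rfl
  le_trans _ _ _ h₁ h₂ := h₁.trans h₂
  le_antisymm P Q h₁ h₂ := Tope.eq_of_sep_eq R P.toTope Q.toTope (h₁.antisymm h₂)

/-- The poset of the topes `T` with `T_e = -R_e`, with the order induced from `𝒯_R`. -/
abbrev OppositeTope (R : L.Tope) (e : E) : Type _ :=
  {T : TopePoset R // T.toTope.toSignVector e = -R.toSignVector e}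

/-- The poset `𝒯_{R,e} = {T ∈ 𝒯 | T_e = -R_e} ∪ {0̂}`, with least element `0̂ = ⊥`. -/
abbrev OppositeTopeBot (R : L.Tope) (e : E) : Type _ := WithBot (OppositeTope R e)

end OrientedMatroid

/-! ### Poset topology -/

/-- The order complex of a poset: its faces are the nonempty finite chains. -/
def orderComplex (P : Type*) [PartialOrder P] : AbstractSimplicialComplex P where
  faces := {s | s.Nonempty ∧ IsChain (· ≤ ·) (s : Set P)}
  isRelLowerSet_faces := fun _ hs =>
    ⟨hs.1, fun _ hts ht => ⟨ht, hs.2.mono (Finset.coe_subset.2 hts)⟩⟩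
  singleton_mem v := ⟨Finset.singleton_nonempty v, by simp⟩

open Classical in
/-- The geometric realization of an abstract simplicial complex `K` on a finite vertex set `V`,
with the subspace topology from `V → ℝ`: the points of the standard simplex on `V` whose support
(the set of vertices with nonzero barycentric coordinate) is a face of `K`. -/
def AbstractSimplicialComplex.Realization {V : Type*} [Finite V]
    (K : AbstractSimplicialComplex V) : Type _ :=
  letI := Fintype.ofFinite V
  {w : V → ℝ // w ∈ stdSimplex ℝ V ∧ Finset.univ.filter (fun v => w v ≠ 0) ∈ K.faces}

instance {V : Type*} [Finite V] (K : AbstractSimplicialComplex V) :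
    TopologicalSpace K.Realization :=
  instTopologicalSpaceSubtype (X := V → ℝ)

/-- A finite poset is contractible if the geometric realization of its order complex is. -/
def PosetContractible (P : Type*) [PartialOrder P] [Finite P] : Prop :=
  ContractibleSpace (orderComplex P).Realization

open Classical in
/-- The Möbius number of a finite poset `P`: the value `μ(0̂, 1̂)` of the Möbius function of the
poset `P ∪ {0̂, 1̂}` obtained from `P` by adjoining a new least and a new greatest element. -/
noncomputable def moebiusNumber (P : Type*) [PartialOrder P] [Finite P] : ℤ :=
  letI := Fintype.ofFinite P
  letI : LocallyFiniteOrder (WithBot (WithTop P)) := Fintype.toLocallyFiniteOrder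
  IncidenceAlgebra.mu ℤ (⊥ : WithBot (WithTop P)) ⊤

/-! The proof rests on the map `T ↦ F ∘ T`. As `F ≤ R`, composing with `F` resets `T` to agree with
`R` on the support of `F`, so it intersects `Sep(R, T)` with the zero set of `F` (`sep_compLeft`).
The map is therefore monotone, decreasing and idempotent, and `F_e = 0` keeps it among the topes
opposite to `R` at `e`. If `P_top` is not in `star(F)`, then `F ∘ P_top` is strictly below `P_top`,
and every `T` in the interval satisfies `T ≥ F ∘ T ≤ F ∘ P_top`.

Such a conical contraction gives both claims independently: an explicit homotopy on the order
complex (`posetContractible_of_le_of_le`), and a fibrewise cancellation of Möbius values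
(`moebiusNumber_eq_zero_of_interior`). -/

/-! ### Möbius numbers of conically contractible posets -/

section Moebius

open Finset

/-- If the fixed points of an interior operator on a bounded poset have a unique coatom, then
`μ(⊥, ⊤) = 0`. -/
theorem IncidenceAlgebra.mu_bot_top_eq_zero_of_interior {A : Type*} [PartialOrder A]
    [BoundedOrder A] [LocallyFiniteOrder A] [DecidableEq A] [Fintype A] (f : A → A)
    (hmono : Monotone f) (hle : ∀ x, f x ≤ x) (hidem : ∀ x, f (f x) = f x)
    (hbot : ∀ x, f x = ⊥ → x = ⊥) (a : A) (ha_bot : a ≠ ⊥) (ha_top : a ≠ ⊤)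
    (hfa : f a = a) (hfle : ∀ x ≠ ⊤, f x ≤ a) :
    IncidenceAlgebra.mu ℤ (⊥ : A) ⊤ = 0 := by
  classical
  set u : A → ℤ := fun y => IncidenceAlgebra.mu ℤ y ⊤
  have hsum : ∀ x : A, x ≠ ⊤ → ∑ y with x ≤ y, u y = 0 := by
    intro x hx
    have h := IncidenceAlgebra.sum_Icc_mu_left (𝕜 := ℤ) x (⊤ : A)
    rw [if_neg hx] at h
    rw [← h]
    exact sum_congr (by ext; simp) fun _ _ => rfl
  -- Downward induction on `z`: subtract the vanishing sum over `y ≥ a` from the one over `y ≥ z`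
  -- and group by fibres of `f`. Fibres over fixed `c ≥ a` cancel, those over other fixed `c > z`
  -- vanish by induction, and all remaining ones except that of `z` contribute nothing.
  have key : ∀ z : A, f z = z → z ≠ ⊤ → z ≠ a → ∑ y with f y = z, u y = 0 := by
    intro z
    induction z using (wellFounded_gt (α := A)).induction with
    | _ z ih =>
      intro hz hz_top hza
      have hza' : z ≤ a := hz ▸ hfle z hz_top
      have h1 := hsum z hz_top
      have h2 := hsum a ha_top
      rw [← sum_fiberwise (univ.filter (z ≤ ·)) f u] at h1
      rw [← sum_fiberwise (univ.filter (a ≤ ·)) f u] at h2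
      have h3 : ∑ c, ((∑ y ∈ univ.filter (z ≤ ·) with f y = c, u y) -
          ∑ y ∈ univ.filter (a ≤ ·) with f y = c, u y) = 0 := by
        rw [sum_sub_distrib, h1, h2, sub_zero]
      rw [sum_eq_single z] at h3
      · rw [sum_eq_zero (s := (univ.filter (a ≤ ·)).filter _), sub_zero] at h3
        · rw [← h3]
          refine sum_congr ?_ fun _ _ => rfl
          ext y
          simp only [mem_filter, mem_univ, true_and]
          exact ⟨fun h => ⟨h ▸ hle y, h⟩, fun h => h.2⟩
        · intro y hy
          simp only [mem_filter, mem_univ, true_and] at hy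
          exact absurd (hza'.antisymm (hy.2 ▸ hfa ▸ hmono hy.1)) hza
      · intro c _ hcz
        by_cases hc : f c = c ∧ z ≤ c
        · by_cases hca : a ≤ c
          · rw [sub_eq_zero]
            refine sum_congr ?_ fun _ _ => rfl
            ext y
            simp only [mem_filter, mem_univ, true_and]
            exact ⟨fun h => ⟨hca.trans (h.2 ▸ hle y), h.2⟩, fun h => ⟨hza'.trans h.1, h.2⟩⟩
          · rw [sum_eq_zero (s := (univ.filter (a ≤ ·)).filter _), sub_zero]
            · rw [← ih c (lt_of_le_of_ne hc.2 hcz.symm) hc.1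
                (fun h => hca (h ▸ le_top)) (fun h => hca h.ge)]
              refine sum_congr ?_ fun _ _ => rfl
              ext y
              simp only [mem_filter, mem_univ, true_and]
              exact ⟨fun h => h.2, fun h => ⟨hc.2.trans (h ▸ hle y), h⟩⟩
            · intro y hy
              simp only [mem_filter, mem_univ, true_and] at hy
              exact absurd (hy.2 ▸ hfa ▸ hmono hy.1) hca
        · have hno : ∀ y, z ≤ y → f y = c → False := fun y hy hyc =>
            hc ⟨hyc ▸ hidem y, hyc ▸ hz ▸ hmono hy⟩
          rw [sum_eq_zero, sum_eq_zero, sub_zero]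
          · intro y hy
            simp only [mem_filter, mem_univ, true_and] at hy
            exact (hno y (hza'.trans hy.1) hy.2).elim
          · intro y hy
            simp only [mem_filter, mem_univ, true_and] at hy
            exact (hno y hy.1 hy.2).elim
      · simp
  -- The fibre over `⊥` is `{⊥}`, so its sum is the Möbius value itself.
  have hbt : (⊥ : A) ≠ ⊤ := fun h => ha_top (eq_top_iff.2 (h ▸ bot_le))
  have h := key ⊥ (le_bot_iff.1 (hle ⊥)) hbt ha_bot.symm
  rw [sum_eq_single (⊥ : A)] at h
  · exact h
  · intro y hy hy'
    exact absurd (hbot y (mem_filter.1 hy).2) hy'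
  · intro h'
    simp [le_bot_iff.1 (hle ⊥)] at h'

/-- A finite poset with an idempotent monotone map `f ≤ id` whose values are bounded by one of
its fixed points has Möbius number `0`. -/
theorem moebiusNumber_eq_zero_of_interior {Q : Type*} [PartialOrder Q] [Finite Q] (f : Q → Q)
    (hmono : Monotone f) (hle : ∀ x, f x ≤ x) (hidem : ∀ x, f (f x) = f x) (a : Q)
    (hfa : f a = a) (hfle : ∀ x, f x ≤ a) : moebiusNumber Q = 0 := by
  classical
  let := Fintype.ofFinite Q
  let : LocallyFiniteOrder (WithBot (WithTop Q)) := Fintype.toLocallyFiniteOrder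
  refine IncidenceAlgebra.mu_bot_top_eq_zero_of_interior
    (WithBot.map (WithTop.map f)) ?_ ?_ ?_ ?_ ((a : WithTop Q) : WithBot (WithTop Q)) ?_ ?_ ?_ ?_
  · exact (hmono.withTop_map).withBot_map
  · intro x
    induction x with
    | bot => simp
    | coe x =>
      induction x with
      | top => simp
      | coe x => simpa using hle x
  · intro x
    induction x with
    | bot => simp
    | coe x =>
      induction x with
      | top => rfl
      | coe x => simpa using hidem x
  · intro x hx
    simpa using hx
  · exact WithBot.coe_ne_bot
  · intro h
    exact WithTop.coe_ne_top (WithBot.coe_injective h)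
  · simpa using hfa
  · intro x hx
    induction x with
    | bot => simp
    | coe x =>
      induction x with
      | top => exact absurd rfl hx
      | coe x => simpa using hfle x

end Moebius

/-! ### Contractibility of conically contractible posets -/

section OrderComplexHomotopy

open Finset unitInterval

/-- The points of the standard simplex on `P` that are supported on a chain. -/
def chainSimplex (P : Type*) [PartialOrder P] [Fintype P] : Set (P → ℝ) :=
  {w | w ∈ stdSimplex ℝ P ∧ IsChain (· ≤ ·) (Function.support w)}

/-- The realization of the order complex consists of the points of `chainSimplex`. -/
theorem posetContractible_iff (P : Type*) [PartialOrder P] [Fintype P] :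
    PosetContractible P ↔ ContractibleSpace (chainSimplex P) := by
  classical
  have hset : {w : P → ℝ | w ∈ @stdSimplex ℝ P _ _ (Fintype.ofFinite P) ∧
      (@Finset.univ P (Fintype.ofFinite P)).filter (fun v => w v ≠ 0) ∈ (orderComplex P).faces} =
      chainSimplex P := by
    rw [Subsingleton.elim (Fintype.ofFinite P) inferInstance]
    ext w
    refine and_congr_right fun hw => ?_
    have hsupp : ((Finset.univ.filter fun v => w v ≠ 0 : Finset P) : Set P) =
        Function.support w := by
      ext; simp
    change (_ ∧ IsChain (· ≤ ·) (_ : Set P)) ↔ _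
    rw [hsupp]
    refine and_iff_right ?_
    by_contra hne
    rw [Finset.not_nonempty_iff_eq_empty, Finset.filter_eq_empty_iff] at hne
    have h0 : ∑ v, w v = 0 := Finset.sum_eq_zero fun v hv => not_not.1 (hne hv)
    exact zero_ne_one (h0.symm.trans hw.2)
  exact (Homeomorph.setCongr hset).contractibleSpace_iff

variable {P : Type*} [Fintype P]

open Classical in
/-- The push-forward of a weight function along `f`. -/
noncomputable def pushWeight (f : P → P) (w : P → ℝ) (q : P) : ℝ :=
  ∑ p with f p = q, w p

theorem sum_pushWeight (f : P → P) (w : P → ℝ) : ∑ q, pushWeight f w q = ∑ p, w p := by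
  classical
  exact sum_fiberwise univ f w

theorem pushWeight_nonneg {f : P → P} {w : P → ℝ} (hw : ∀ p, 0 ≤ w p) (q : P) :
    0 ≤ pushWeight f w q :=
  sum_nonneg fun p _ => hw p

theorem exists_of_pushWeight_ne_zero {f : P → P} {w : P → ℝ} {q : P}
    (h : pushWeight f w q ≠ 0) : ∃ p, f p = q ∧ w p ≠ 0 := by
  classical
  obtain ⟨p, hp, hp'⟩ := exists_ne_zero_of_sum_ne_zero h
  exact ⟨p, (mem_filter.1 hp).2, hp'⟩

@[fun_prop]
theorem continuous_pushWeight (f : P → P) : Continuous (pushWeight f) := by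
  unfold pushWeight
  fun_prop

variable [PartialOrder P]

open Classical in
/-- The part of the weight `w` that remains when one collects the total amount `t` of weight
starting from the bottom of the support. -/
noncomputable def lowerWeight (t : ℝ) (w : P → ℝ) (p : P) : ℝ :=
  min (w p) (max 0 (t - ∑ q with q < p, w q))

theorem lowerWeight_nonneg {w : P → ℝ} (hw : ∀ p, 0 ≤ w p) (t : ℝ) (p : P) :
    0 ≤ lowerWeight t w p :=
  le_min (hw p) (le_max_left _ _)

theorem lowerWeight_le (t : ℝ) (w : P → ℝ) (p : P) : lowerWeight t w p ≤ w p :=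
  min_le_left _ _

theorem lowerWeight_zero {w : P → ℝ} (hw : ∀ p, 0 ≤ w p) (p : P) : lowerWeight 0 w p = 0 := by
  classical
  unfold lowerWeight
  rw [max_eq_left, min_eq_right (hw p)]
  rw [zero_sub]
  exact neg_nonpos.2 (sum_nonneg fun q _ => hw q)

theorem lowerWeight_one {w : P → ℝ} (hw : w ∈ stdSimplex ℝ P) (p : P) :
    lowerWeight 1 w p = w p := by
  classical
  unfold lowerWeight
  refine min_eq_left (le_max_of_le_right ?_)
  have h : ∑ q ∈ insert p (univ.filter (· < p)), w q ≤ ∑ q, w q :=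
    sum_le_sum_of_subset_of_nonneg (subset_univ _) fun q _ _ => hw.1 q
  rw [sum_insert (by simp), hw.2] at h
  linarith

/-- Weight is collected from the bottom: the collected part lies below the rest. -/
theorem le_of_lowerWeight_ne_zero {w : P → ℝ} (hw : w ∈ chainSimplex P) {t : ℝ} {p q : P}
    (hp : lowerWeight t w p ≠ 0) (hq : lowerWeight t w q ≠ w q) : p ≤ q := by
  classical
  have hwp : w p ≠ 0 := fun h => hp <|
    le_antisymm (h ▸ lowerWeight_le t w p) (lowerWeight_nonneg hw.1.1 t p)
  have hwq : w q ≠ 0 := fun h => hq <|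
    le_antisymm (lowerWeight_le t w q) (h ▸ lowerWeight_nonneg hw.1.1 t q)
  by_contra hpq
  have hqp : q < p :=
    lt_of_le_of_ne ((hw.2.total hwp hwq).resolve_left hpq) fun h => hpq h.ge
  -- Reaching `p` means that the weight strictly below `p`, which includes that of `q`, is less than
  -- `t`; not exhausting `q` means that the weight up to `q` exceeds `t`.
  have h1 : ∑ r with r < p, w r < t := by
    by_contra h
    apply hp
    unfold lowerWeight
    rw [max_eq_left (by linarith), min_eq_right (hw.1.1 p)]
  have h2 : t - ∑ r with r < q, w r < w q := by
    by_contra h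
    apply hq
    unfold lowerWeight
    exact min_eq_left (le_max_of_le_right (not_lt.1 h))
  have h3 : ∑ r ∈ insert q (univ.filter (· < q)), w r ≤ ∑ r with r < p, w r := by
    refine sum_le_sum_of_subset_of_nonneg ?_ fun r _ _ => hw.1.1 r
    intro r hr
    simp only [mem_insert, mem_filter, mem_univ, true_and] at hr ⊢
    rcases hr with rfl | hr
    · exact hqp
    · exact hr.trans hqp
  rw [sum_insert (by simp)] at h3
  linarith

@[fun_prop]
theorem continuous_lowerWeight :
    Continuous fun x : ℝ × (P → ℝ) => lowerWeight x.1 x.2 := by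
  unfold lowerWeight
  fun_prop

/-- Push the lowest part, of total weight `t`, of the weight `w` forward along `f`. -/
noncomputable def pushLower (f : P → P) (t : ℝ) (w : P → ℝ) (q : P) : ℝ :=
  pushWeight f (lowerWeight t w) q + (w q - lowerWeight t w q)

/-- Moving all the weight at once could leave the chains, since `f p` need not be comparable with
some `q < p`. Moving it from the bottom up avoids this: if `p` has moved weight and `q` has unmoved
weight, then `f p ≤ p ≤ q`. -/
theorem pushLower_mem {f : P → P} (hmono : Monotone f) (hle : ∀ p, f p ≤ p) (t : ℝ) {w : P → ℝ}
    (hw : w ∈ chainSimplex P) : pushLower f t w ∈ chainSimplex P := by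
  refine ⟨⟨fun q => add_nonneg (pushWeight_nonneg (lowerWeight_nonneg hw.1.1 t) q)
    (sub_nonneg.2 (lowerWeight_le t w q)), ?_⟩, ?_⟩
  · simp only [pushLower, sum_add_distrib, sum_sub_distrib, sum_pushWeight, hw.1.2]
    ring
  · have hsupp : ∀ q ∈ Function.support (pushLower f t w),
        (∃ p, f p = q ∧ lowerWeight t w p ≠ 0) ∨ lowerWeight t w q ≠ w q := by
      intro q hq
      by_contra! h
      apply hq
      unfold pushLower
      rw [h.2, sub_self, add_zero]
      by_contra h0
      obtain ⟨p, hp, hp'⟩ := exists_of_pushWeight_ne_zero h0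
      exact hp' (h.1 p hp)
    have hne : ∀ p, lowerWeight t w p ≠ 0 → p ∈ Function.support w := fun p hp h =>
      hp (le_antisymm (h ▸ lowerWeight_le t w p) (lowerWeight_nonneg hw.1.1 t p))
    have hne' : ∀ p, lowerWeight t w p ≠ w p → p ∈ Function.support w := fun p hp h =>
      hp (le_antisymm (lowerWeight_le t w p) (h ▸ lowerWeight_nonneg hw.1.1 t p))
    intro x hx y hy _
    rcases hsupp x hx with ⟨p, rfl, hp⟩ | hx'
    · rcases hsupp y hy with ⟨q, rfl, hq⟩ | hy'
      · exact (hw.2.total (hne p hp) (hne q hq)).imp (fun h => hmono h) fun h => hmono h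
      · exact Or.inl ((hle p).trans (le_of_lowerWeight_ne_zero hw hp hy'))
    · rcases hsupp y hy with ⟨q, rfl, hq⟩ | hy'
      · exact Or.inr ((hle q).trans (le_of_lowerWeight_ne_zero hw hq hx'))
      · exact hw.2.total (hne' x hx') (hne' y hy')

theorem pushLower_zero (f : P → P) {w : P → ℝ} (hw : ∀ p, 0 ≤ w p) : pushLower f 0 w = w := by
  funext q
  have h : lowerWeight 0 w = fun _ => 0 := funext (lowerWeight_zero hw)
  simp [pushLower, pushWeight, h]

theorem pushLower_one (f : P → P) {w : P → ℝ} (hw : w ∈ stdSimplex ℝ P) :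
    pushLower f 1 w = pushWeight f w := by
  funext q
  have h : lowerWeight 1 w = w := funext (lowerWeight_one hw)
  simp [pushLower, h]

theorem continuous_pushLower (f : P → P) :
    Continuous fun x : ℝ × (P → ℝ) => pushLower f x.1 x.2 := by
  unfold pushLower
  refine continuous_pi fun q => ?_
  have h := continuous_lowerWeight (P := P)
  have h1 := (continuous_pi_iff.1 ((continuous_pushWeight f).comp h)) q
  have h2 := continuous_pi_iff.1 h q
  exact h1.add (((continuous_apply q).comp continuous_snd).sub h2)

-- The image of a chain under `f` is a chain below `a`, so adding `a` keeps it a chain and the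
-- straight segment to the vertex `a` is available.
open Classical in
theorem convexComb_pushWeight_single_mem {f : P → P} (hmono : Monotone f) {a : P}
    (hfle : ∀ p, f p ≤ a) {t : ℝ} (ht : t ∈ Set.Icc (0 : ℝ) 1) {w : P → ℝ}
    (hw : w ∈ chainSimplex P) :
    (1 - t) • pushWeight f w + t • Pi.single a (1 : ℝ) ∈ chainSimplex P := by
  refine ⟨convex_stdSimplex ℝ P ⟨pushWeight_nonneg hw.1.1, (sum_pushWeight f w).trans hw.1.2⟩
    (single_mem_stdSimplex ℝ a) (sub_nonneg.2 ht.2) ht.1 (sub_add_cancel _ _), ?_⟩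
  have hsupp : ∀ q ∈ Function.support ((1 - t) • pushWeight f w + t • Pi.single a (1 : ℝ)),
      (∃ p, f p = q ∧ w p ≠ 0) ∨ q = a := by
    intro q hq
    by_contra! h
    apply hq
    have h0 : pushWeight f w q = 0 := by
      by_contra h0
      obtain ⟨p, hp, hp'⟩ := exists_of_pushWeight_ne_zero h0
      exact hp' (h.1 p hp)
    simp [h0, h.2]
  intro x hx y hy _
  rcases hsupp x hx with ⟨p, rfl, hp⟩ | rfl
  · rcases hsupp y hy with ⟨q, rfl, hq⟩ | rfl
    · exact (hw.2.total hp hq).imp (fun h => hmono h) fun h => hmono h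
    · exact Or.inl (hfle p)
  · rcases hsupp y hy with ⟨q, rfl, hq⟩ | rfl
    · exact Or.inr (hfle q)
    · exact Or.inl le_rfl

/-- A finite poset with a monotone map `f` such that `id ≥ f ≤ a` for a constant `a` is
contractible. -/
theorem posetContractible_of_le_of_le {P : Type*} [PartialOrder P] [Finite P] {f : P → P}
    (hmono : Monotone f) (hle : ∀ p, f p ≤ p) {a : P} (hfle : ∀ p, f p ≤ a) :
    PosetContractible P := by
  classical
  let := Fintype.ofFinite P
  rw [posetContractible_iff, contractible_iff_id_nullhomotopic]
  -- Time is the amount of weight already moved: `H₁` runs from the identity to the push-forward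
  -- along `f`, and `H₂` then cones to the vertex `a`.
  let H₁ : C(I × chainSimplex P, chainSimplex P) :=
    ⟨fun x => ⟨pushLower f x.1 x.2, pushLower_mem hmono hle x.1 x.2.2⟩, by
      refine Continuous.subtype_mk ?_ _
      exact (continuous_pushLower f).comp
        ((continuous_subtype_val.comp continuous_fst).prodMk
          (continuous_subtype_val.comp continuous_snd))⟩
  let H₂ : C(I × chainSimplex P, chainSimplex P) :=
    ⟨fun x => ⟨(1 - (x.1 : ℝ)) • pushWeight f x.2 + (x.1 : ℝ) • Pi.single a (1 : ℝ),
      convexComb_pushWeight_single_mem hmono hfle x.1.2 x.2.2⟩, by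
      refine Continuous.subtype_mk ?_ _
      have h : Continuous fun x : I × chainSimplex P => pushWeight f (x.2 : P → ℝ) :=
        (continuous_pushWeight f).comp (continuous_subtype_val.comp continuous_snd)
      fun_prop⟩
  have hsingle : (Pi.single a (1 : ℝ) : P → ℝ) ∈ chainSimplex P :=
    ⟨single_mem_stdSimplex ℝ a, by
      refine Set.Subsingleton.isChain ?_
      exact Set.subsingleton_singleton.anti Pi.support_single_subset⟩
  let g : C(chainSimplex P, chainSimplex P) := H₁.comp ⟨fun w => (1, w), by fun_prop⟩
  refine ⟨⟨Pi.single a 1, hsingle⟩, ContinuousMap.Homotopic.trans (g := g) ⟨⟨H₁, ?_, ?_⟩⟩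
    ⟨⟨H₂, ?_, ?_⟩⟩⟩
  · intro w
    exact Subtype.ext (pushLower_zero f w.2.1.1)
  · intro w
    rfl
  · intro w
    refine Subtype.ext ?_
    change (1 - (0 : ℝ)) • pushWeight f w.1 + (0 : ℝ) • Pi.single a (1 : ℝ) = pushLower f 1 w.1
    rw [pushLower_one f w.2.1]
    simp
  · intro w
    refine Subtype.ext ?_
    change (1 - (1 : ℝ)) • pushWeight f w.1 + (1 : ℝ) • Pi.single a (1 : ℝ) = Pi.single a 1
    simp

end OrderComplexHomotopy

/-! ### Composition with a face of the base tope -/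

namespace OrientedMatroid

open SignVector

variable {E : Type*} {L : OrientedMatroid E}

/-- The tope `F ∘ T`. -/
def Tope.compLeft (F : SignVector E) (hF : F ∈ L.covectors) (T : L.Tope) : L.Tope :=
  ⟨F.comp T, L.comp_mem _ hF _ T.2.1, fun Y hY hle f => by
    -- A zero of `F ∘ T` is a zero of `T`; maximality of `T` against `T ∘ Y` makes `Y` vanish there
    -- too.
    by_cases h0 : F.comp T.toSignVector f = 0
    · left
      have hT : T.toSignVector f = 0 := by
        by_cases hFf : F f = 0
        · simpa [comp, hFf] using h0
        · simp [comp, hFf] at h0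
      have hTY : T.toSignVector ≤ T.toSignVector.comp Y := fun g => by
        by_cases hg : T.toSignVector g = 0
        · exact Or.inl hg
        · exact Or.inr (if_neg hg).symm
      have h := T.2.2 (L.comp_mem _ T.2.1 _ hY) hTY f
      change T.toSignVector.comp Y f = 0 ∨ T.toSignVector.comp Y f = T.toSignVector f at h
      simpa [comp, hT] using h
    · exact Or.inr ((hle f).resolve_left h0).symm⟩

theorem Tope.compLeft_apply (F : SignVector E) (hF : F ∈ L.covectors) (T : L.Tope) (f : E) :
    (T.compLeft F hF).toSignVector f = if F f = 0 then T.toSignVector f else F f := rfl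

/-- On the support of `F` the composition agrees with `R`; elsewhere it agrees with `T`. -/
theorem sep_compLeft {R : L.Tope} {F : SignVector E} (hF : F ∈ L.covectors)
    (hFR : F ≤ R.toSignVector) (T : L.Tope) :
    R.toSignVector.sep (T.compLeft F hF).toSignVector =
      R.toSignVector.sep T.toSignVector ∩ {f | F f = 0} := by
  ext f
  simp only [sep, Set.mem_ofPred_eq, Set.mem_inter_iff, Tope.compLeft_apply]
  rcases hFR f with h | h
  · simp [h]
  · by_cases h0 : F f = 0
    · simp [h0]
    · have : F f ≠ -F f := by
        revert h0
        generalize F f = s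
        revert s
        decide
      simp [h0, ← h, this]

/-- The map `T ↦ F ∘ T` on the topes `T` with `T_e = -R_e`. -/
def OppositeTope.compLeft {R : L.Tope} {e : E} (F : SignVector E) (hF : F ∈ L.covectors)
    (hFe : F e = 0) (T : OppositeTope R e) : OppositeTope R e :=
  ⟨(T.1.toTope.compLeft F hF : L.Tope), (if_pos hFe).trans T.2⟩

section

variable {R : L.Tope} {e : E} {F : SignVector E} (hF : F ∈ L.covectors) (hFe : F e = 0)

theorem OppositeTope.monotone_compLeft (hFR : F ≤ R.toSignVector) :
    Monotone (OppositeTope.compLeft (R := R) F hF hFe) := by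
  intro S T h
  change R.toSignVector.sep (S.1.toTope.compLeft F hF).toSignVector ⊆
    R.toSignVector.sep (T.1.toTope.compLeft F hF).toSignVector
  rw [sep_compLeft hF hFR, sep_compLeft hF hFR]
  exact Set.inter_subset_inter_left _ h

theorem OppositeTope.compLeft_le (hFR : F ≤ R.toSignVector) (T : OppositeTope R e) :
    T.compLeft F hF hFe ≤ T := by
  change R.toSignVector.sep (T.1.toTope.compLeft F hF).toSignVector ⊆
    R.toSignVector.sep T.1.toTope.toSignVector
  rw [sep_compLeft hF hFR]
  exact Set.inter_subset_left

theorem OppositeTope.compLeft_compLeft (T : OppositeTope R e) :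
    (T.compLeft F hF hFe).compLeft F hF hFe = T.compLeft F hF hFe := by
  apply Subtype.ext
  apply Subtype.ext
  funext f
  change (if F f = 0 then (if F f = 0 then _ else _) else _) = if F f = 0 then _ else _
  split_ifs <;> rfl

theorem OppositeTope.mem_star_of_compLeft_eq {T : OppositeTope R e}
    (h : T.compLeft F hF hFe = T) : T.1.toTope ∈ star (L := L) F := by
  intro f
  have hf : (T.compLeft F hF hFe).1.toTope.toSignVector f = T.1.toTope.toSignVector f := by rw [h]
  change (if F f = 0 then _ else _) = _ at hf
  by_cases h0 : F f = 0
  · exact Or.inl h0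
  · exact Or.inr (by rwa [if_neg h0] at hf)

end

end OrientedMatroid
open OrientedMatroid in
theorem theorem3p5 {E : Type*} [Finite E] (L : OrientedMatroid E) (R : L.Tope) (e : E)
    (he : OrientedMatroid.DefinesProperFace e R)
    (F : SignVector E)
    (hF : Maximal (fun X => X ∈ L.covectors ∧ X ≤ (R : SignVector E) ∧ X e = 0) F)
    (P_top : OrientedMatroid.OppositeTope R e)
    (hP : P_top.1.toTope ∉ OrientedMatroid.star F) :
    PosetContractible
        (Set.Ioo (⊥ : OrientedMatroid.OppositeTopeBot R e) P_top) ∧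
      moebiusNumber
        (Set.Ioo (⊥ : OrientedMatroid.OppositeTopeBot R e) P_top) = 0 := by
  obtain ⟨⟨hFL, hFR, hFe⟩, -⟩ := hF
  let c : OppositeTope R e → OppositeTope R e := OppositeTope.compLeft F hFL hFe
  have hmono : Monotone c := OppositeTope.monotone_compLeft hFL hFe hFR
  have hle : ∀ T, c T ≤ T := OppositeTope.compLeft_le hFL hFe hFR
  have hidem : ∀ T, c (c T) = c T := OppositeTope.compLeft_compLeft hFL hFe
  have hlt : c P_top < P_top :=
    lt_of_le_of_ne (hle _) fun h => hP (OppositeTope.mem_star_of_compLeft_eq hFL hFe h)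
  have hmap_le : ∀ x : OppositeTopeBot R e, x.map c ≤ x := by
    intro x
    induction x using WithBot.recBotCoe with
    | bot => exact bot_le
    | coe T => exact WithBot.coe_le_coe.2 (hle T)
  let f : Set.Ioo (⊥ : OppositeTopeBot R e) P_top → Set.Ioo (⊥ : OppositeTopeBot R e) P_top :=
    fun x => ⟨x.1.map c, bot_lt_iff_ne_bot.2 fun h => x.2.1.ne' (WithBot.map_eq_bot_iff.1 h),
      (hmap_le x.1).trans_lt x.2.2⟩
  have hf_mono : Monotone f := fun x y h => hmono.withBot_map h
  have hf_le : ∀ x, f x ≤ x := fun x => hmap_le x.1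
  -- The cone point `F ∘ P_top` lies in the open interval because `hlt` is strict.
  let a : Set.Ioo (⊥ : OppositeTopeBot R e) P_top :=
    ⟨c P_top, WithBot.bot_lt_coe _, WithBot.coe_lt_coe.2 hlt⟩
  have hf_le_a : ∀ x, f x ≤ a := fun x => hmono.withBot_map x.2.2.le
  refine ⟨posetContractible_of_le_of_le hf_mono hf_le hf_le_a,
    moebiusNumber_eq_zero_of_interior f hf_mono hf_le (fun x => Subtype.ext ?_) a
      (Subtype.ext (congrArg WithBot.some (hidem P_top))) hf_le_a⟩
  change (x.1.map c).map c = x.1.map c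
  rw [WithBot.map_map]
  exact congrArg (fun g => WithBot.map g x.1) (funext hidem)
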